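/- **Setting.** Let $\mathbb F_2$ be the free group on $T_1,T_2$, let $X=\{-1,1\}^{\mathbb F_2}$ carry the product $m$ of the uniform measures on $\{-1,1\}$, let $\mathbb F_2$ act on $X$ by the shift $(gx)^h=x^{g^{-1}h}$, and let $X'=\{x: gx\neq x \text{ for all } g\neq 1\}$. For $x\in X$ put $t_i(x)=T_i^{\,x^e}x$ $(i=1,2)$; these are the two points toward which an arrow could be directed from $x$. *Paradoxical rules.* A colouring rule with colour set $A$ (a measurable space) consists of finitely many maps $x\mapsto x_1,\dots,x_k$ of $X$ (the descendants), which preserve $m$ and satisfy $x_i\ne x$ for almost every $x$, and a correspondence $F:X\times A^k\to 2^A$ whose graph is measurable (with respect to the completion of $m$ on $X$). A colouring $c:X\to A$ satisfies the rule if $c(x)\in F(x,c(x_1),\dots,c(x_k))$ for $m$-almost every $x$. The rule is paradoxical if some colouring satisfies it, but for every finitely additive measure $\mu$ on an algebra of subsets of $X$ that extends $m$ and is preserved by all descendant maps, no colouring satisfying the rule is $\mu$-measurable. *Fundamental rule.* Each $x$ gets an active colour $i\in\{1,2\}$ (an arrow is directed from $x$ to $t_i(x)$) and a passive colour $c$ (crowded)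 or $u$ (uncrowded). If exactly one of $t_1(x),t_2(x)$ is crowded, then the arrow of $x$ must be directed to the uncrowded one; $x$ is crowded if and only if at least two arrows are directed to $x$. *Secondary graph and lists.* Let $g_1,\dots,g_4$ be $T_1T_2^{-1},\,T_1^{-1}T_2,\,T_2T_1^{-1},\,T_2^{-1}T_1$ and let $g_5,\dots,g_{16}$ be the twelve words of length four that are products of two of them. An original colouring is a partition of $X'$ into $17$ Borel sets (the colours) such that $x$ and $g_ix$ lie in different sets for all $x\in X'$ and $1\le i\le 16$; write $c_0(x)$ for the colour of $x$. The list of $x\in X'$ is $L(x)=\{c_0(t_1(x)),c_0(t_2(x))\}$. In the secondary graph two distinct points $x,y\in X'$ are adjacent if there is a point $z$ toward which an arrow could be directed both from $x$ and from $y$; points outside $X'$ have no adjacencies. Proper list colouring is the rule that the colour of $x$ belongs to $L(x)$ and differs from the colours of all points adjacent to $x$; its descendants are the twelve translates of $x$ by the reduced words of length two (all points adjacent to $x$ are among them). **Proposition.** An original colouring exists. For every original colouring $c_0$, $|L(x)|=2$ for every $x\in X'$, and proper list colouring of the secondary graph is a paradoxical colouring rule. Moreover: 1. If $c$ is a proper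 list colouring almost everywhere, then for almost every $x$ there is exactly one $a(x)\in\{1,2\}$ with $c(x)=c_0(t_{a(x)}(x))$, and the arrow map $x\mapsto t_{a(x)}(x)$ is injective off an $m$-null set. 2. If $\mu$ is a finitely additive $\mathbb F_2$-invariant extension of $m$ to an algebra of subsets of $X$, then no function $a:X\to\{1,2\}$ for which $x\mapsto t_{a(x)}(x)$ is injective off an $m$-null set is $\mu$-measurable. 3. If a colouring satisfies the fundamental rule almost everywhere and $a(x)$ is the active colour of $x$, then $x\mapsto c_0(t_{a(x)}(x))$ is a proper list colouring almost everywhere. -/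

import Mathlib

open MeasureTheory
open scoped ENNReal Pointwise

namespace ParadoxicalColouring

/-! ### Colouring rules and paradoxicality -/

/-- The data of a colouring rule on `X` with colours in `A`: finitely many descendants
`desc i x` of every point `x`, and a correspondence `F` giving the set of colours allowed at `x`
when `b i` is the colour of the descendant `desc i x`. -/
structure Rule (X A ι : Type*) where
  desc : ι → X → X
  F : X → (ι → A) → Set A

/-- The requirements on a colouring rule over a probability space `(X, m)`: the descendants are
measure preserving and almost everywhere different from the point itself, and the graph of the
correspondence is measurable, where `X` carries the completion of its σ-algebra with respect
to `m` (the measurable sets of `NullMeasurableSpace X m`). -/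
structure Rule.IsColouringRule {X A ι : Type*} [MeasurableSpace X] [MeasurableSpace A]
    (R : Rule X A ι) (m : Measure X) : Prop where
  measurePreserving : ∀ i, MeasurePreserving (R.desc i) m m
  irreflexive : ∀ᵐ x ∂m, ∀ i, R.desc i x ≠ x
  measurableSet_graph :
    MeasurableSet {p : A × (NullMeasurableSpace X m × (ι → A)) | p.1 ∈ R.F p.2.1 p.2.2}

/-- The colouring `c` satisfies the rule `R` (almost everywhere). -/
def Rule.Satisfies {X A ι : Type*} [MeasurableSpace X] (R : Rule X A ι) (m : Measure X)
    (c : X → A) : Prop :=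
  ∀ᵐ x ∂m, c x ∈ R.F x (fun i => c (R.desc i x))

/-- `μ` is a finitely additive measure on the algebra of sets `𝒜`, it extends the measure `m`,
and all the maps `T i` are `μ`-measurable and preserve `μ`. -/
structure IsInvariantExtension {X ι : Type*} [MeasurableSpace X] (m : Measure X)
    (𝒜 : Set (Set X)) (μ : AddContent ℝ≥0∞ 𝒜) (T : ι → X → X) : Prop where
  isSetAlgebra : IsSetAlgebra 𝒜
  measurableSet_mem : ∀ S, MeasurableSet S → S ∈ 𝒜
  extends_measure : ∀ S, MeasurableSet S → μ S = m S
  preimage_mem : ∀ i, ∀ S ∈ 𝒜, T i ⁻¹' S ∈ 𝒜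
  preserving : ∀ i, ∀ S ∈ 𝒜, μ (T i ⁻¹' S) = μ S

/-- The rule `R` is paradoxical: some colouring satisfies it, but no colouring satisfying it is
measurable for a finitely additive extension of `m` that the descendants preserve. -/
def Rule.IsParadoxical {X A ι : Type*} [MeasurableSpace X] [MeasurableSpace A]
    (R : Rule X A ι) (m : Measure X) : Prop :=
  (∃ c : X → A, R.Satisfies m c) ∧
  ∀ (𝒜 : Set (Set X)) (μ : AddContent ℝ≥0∞ 𝒜), IsInvariantExtension m 𝒜 μ R.desc →
    ¬ ∃ c : X → A, R.Satisfies m c ∧ ∀ D : Set A, MeasurableSet D → c ⁻¹' D ∈ 𝒜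

/-! ### The space `{-1, 1} ^ F₂` -/

/-- The free group on two generators. -/
abbrev F₂ : Type := FreeGroup (Fin 2)

/-- The two generators of the free group. -/
def T (i : Fin 2) : F₂ := FreeGroup.of i

/-- The space `{-1, 1} ^ F₂`; the type `ℤˣ` has exactly the two elements `1` and `-1`. -/
abbrev Config : Type := F₂ → ℤˣ

/-- The shift action of the free group. -/
instance shiftAction : MulAction F₂ Config where
  smul g x := fun h => x (g⁻¹ * h)
  one_smul x := by
    funext h
    change x ((1 : F₂)⁻¹ * h) = x h
    simp
  mul_smul g k x := by
    funext h
    change x ((g * k)⁻¹ * h) = x (k⁻¹ * (g⁻¹ * h))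
    simp [mul_assoc]

/-- The product measure: the coordinates are independent and uniform on `{-1, 1}`. -/
noncomputable def coinMeasure : Measure Config :=
  Measure.infinitePi (fun _ : F₂ => (PMF.uniformOfFintype ℤˣ).toMeasure)

/-- The set of configurations on whose orbits the free group acts freely. -/
def freePart : Set Config := {x | ∀ g : F₂, g ≠ 1 → g • x ≠ x}

/-! ### Potential arrows, and the fundamental rule -/

/-- The `i`-th point toward which an arrow could be directed from `x`: it is `T i • x` if the
coordinate of `x` at the identity is `1`, and `(T i)⁻¹ • x` if that coordinate is `-1`. -/
def target (i : Fin 2) (x : Config) : Config := (T i ^ ((x 1 : ℤˣ) : ℤ)) • x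

/-- An arrow could be directed from `x` to `z`. -/
def CanPoint (x z : Config) : Prop := ∃ i, z = target i x

/-- A letter `(i, s)` stands for the group element `T i ^ s`. -/
abbrev Letter : Type := Fin 2 × ℤˣ

/-- The group element of a letter. -/
def Letter.val (l : Letter) : F₂ := T l.1 ^ ((l.2 : ℤˣ) : ℤ)

/-- Given the colours `b` of the four neighbours of `x`, an arrow is directed toward `x` from its
neighbour `l.val • x`: the neighbour can use the inverse of `l.val`, and its active colour is the
index of the letter `l`. -/
def Incoming (x : Config) (b : Letter → Fin 2 × Bool) (l : Letter) : Prop :=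
  (l.val • x) 1 = -l.2 ∧ (b l).1 = l.1

/-- The fundamental rule. A colour consists of an active part in `Fin 2` (the arrow from `x` is
directed to `target i x` for the active colour `i` of `x`) and a passive part in `Bool`, where
`true` means crowded and `false` means uncrowded. The arrow may not be directed to a crowded point
if the other choice is uncrowded, and a point is crowded if and only if at least two arrows are
directed toward it. -/
def fundamentalRule : Rule Config (Fin 2 × Bool) Letter where
  desc l x := l.val • x
  F x b := {a |
    ((∃ j : Fin 2, (b (j, x 1)).2 = false) → (b (a.1, x 1)).2 = false) ∧
    (a.2 = true ↔ 2 ≤ {l : Letter | Incoming x b l}.ncard)}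

/-! ### The original Borel colouring, the lists and the secondary graph -/

/-- The four group elements of length two that move one potential target of a point to the
other one. -/
def shortWords : Finset F₂ :=
  {T 0 * (T 1)⁻¹, (T 0)⁻¹ * T 1, T 1 * (T 0)⁻¹, (T 1)⁻¹ * T 0}

/-- The sixteen group elements `g₁, …, g₁₆`: the four short words, and the twelve words of length
four that are products of two short words. -/
def separationWords : Finset F₂ := shortWords ∪ (shortWords * shortWords).erase 1

/-- `c₀` gives a partition of the free part into `17` Borel sets such that `g • x` and `x` belong
to different sets for each of the sixteen separation words `g`. -/
def IsOriginalColouring (c₀ : Config → Fin 17) : Prop :=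
  Measurable c₀ ∧ ∀ x ∈ freePart, ∀ g ∈ separationWords, c₀ (g • x) ≠ c₀ x

/-- The list of colours allowed at `x`: the original colours of its two potential targets. -/
def colourList (c₀ : Config → Fin 17) (x : Config) : Finset (Fin 17) :=
  Finset.univ.image (fun i : Fin 2 => c₀ (target i x))

/-- The secondary graph: two distinct points of the free part are adjacent if from both of them an
arrow could be directed to a common point `z`. There are no adjacencies outside the free part. -/
def secondaryGraph : SimpleGraph Config where
  Adj x y := x ≠ y ∧ x ∈ freePart ∧ y ∈ freePart ∧ ∃ z, CanPoint x z ∧ CanPoint y z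
  symm := ⟨fun _ _ h => ⟨h.1.symm, h.2.2.1, h.2.1, h.2.2.2.imp fun _ hz => ⟨hz.2, hz.1⟩⟩⟩
  loopless := ⟨fun _ h => h.1 rfl⟩

/-- The pairs of distinct letters; they index the twelve group elements of length two. -/
abbrev LetterPair : Type := {p : Letter × Letter // p.1 ≠ p.2}

/-- The rule of proper list colouring of the secondary graph: the colour of `x` belongs to the list
of `x` and differs from the colours of all points adjacent to `x`. The descendants of `x` are its
twelve translates by words of length two; they contain all points adjacent to `x`. -/
def listRule (c₀ : Config → Fin 17) : Rule Config (Fin 17) LetterPair where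
  desc p x := (p.1.2.val⁻¹ * p.1.1.val) • x
  F x b := {a | a ∈ colourList c₀ x ∧
    ∀ p : LetterPair, secondaryGraph.Adj x ((p.1.2.val⁻¹ * p.1.1.val) • x) → a ≠ b p}

/-- Every point adjacent to `x` in the secondary graph is a descendant of `x`. -/
theorem secondaryGraph_adj_desc (c₀ : Config → Fin 17) {x y : Config}
    (h : secondaryGraph.Adj x y) : ∃ p, y = (listRule c₀).desc p x := by
  obtain ⟨hne, -, -, z, ⟨i, hi⟩, ⟨j, hj⟩⟩ := h
  have key : y = ((Letter.val (j, y 1))⁻¹ * Letter.val (i, x 1)) • x := by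
    rw [mul_smul, eq_inv_smul_iff]
    exact hj.symm.trans hi
  refine ⟨⟨((i, x 1), (j, y 1)), fun hp => hne ?_⟩, key⟩
  dsimp only at hp
  rw [hp, inv_mul_cancel, one_smul] at key
  exact key.symm

/-- Satisfying the rule means being, almost everywhere, a proper list colouring of the secondary
graph. -/
theorem listRule_satisfies_iff (c₀ : Config → Fin 17) (m : Measure Config)
    (c : Config → Fin 17) :
    (listRule c₀).Satisfies m c ↔
      ∀ᵐ x ∂m, c x ∈ colourList c₀ x ∧ ∀ y, secondaryGraph.Adj x y → c x ≠ c y := by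
  refine Filter.eventually_congr (Filter.Eventually.of_forall fun x => ?_)
  refine and_congr_right fun _ => ⟨fun h y hy => ?_, fun h p hp => h _ hp⟩
  obtain ⟨p, rfl⟩ := secondaryGraph_adj_desc c₀ hy
  exact h p hy

/-- A choice `a` of one of the two potential arrows at every point is injective (almost
everywhere) if, off a null set, no two arrows are directed to the same point. -/
def IsInjectiveArrowSystem (m : Measure Config) (a : Config → Fin 2) : Prop :=
  ∃ N : Set Config, (∀ᵐ x ∂m, x ∈ N) ∧ Set.InjOn (fun x => target (a x) x) N

end ParadoxicalColouring

open ParadoxicalColouring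

/-!
Call a choice `a` of one of the two potential arrows at every point *injective* if, off a null set,
no two arrows are directed to the same point. Everything goes through such arrow systems.

*Lists.* The two potential targets of a point differ by a short word, so an original colouring
separates them, and the colour of a point taken from its list is the same thing as an arrow. Adjacent
points of the secondary graph share a potential target, so any two of their potential targets differ
by a product of at most two short words and have different original colours unless they coincide.
Hence proper list colourings and injective arrow systems correspond to each other
(`satisfies_listRule_of_isInjectiveArrowSystem`, `isInjectiveArrowSystem_arrowOf`).

*Existence.* On a free orbit, direct all arrows away from a base point; the source of an arrow is then
its target with the first letter removed (`exists_injOn_target`).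

*Paradox.* Move every point along its arrow. An injective system that is measurable for an invariant
finitely additive measure would carry the space to a set of measure `1`. But with probability `1 / 16`
none of the four neighbours of a point could direct an arrow to it
(`not_measurable_of_isInjectiveArrowSystem`). Only translations by quotients of two letters are used,
which are descendant maps of the list rule.

*Fundamental rule.* Consider the graph in which `x` is an edge between its two potential targets. An
arrow directed to a crowded point comes from an edge whose other end is crowded too, so a crowded
point is the root of an infinite binary tree (`SatisfiesOnOrbit.mem_branching`). A point has three
edges besides a given one, each present with probability `1 / 2`, and what lies behind different edges
is independent. So the probability `p n` of a binary tree of depth `n` satisfies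
`p (n + 1) ≤ 3 * (p n / 2) ^ 2` and tends to `0` (`coinMeasure_branching_le`). This rules out crowded
points even for nonmeasurable colourings, and without crowded points the arrows are injective.

*Original colouring.* The free part is covered by countably many measurable sets none of which contains
two points that differ by a separation word. Colour greedily along this cover; sixteen neighbours leave
one of the seventeen colours free (`exists_isOriginalColouring`).
-/

namespace ParadoxicalColouring

/-! ### Letters and reduced words -/

/-- The inverse of a letter, as a letter. -/
def Letter.flip (l : Letter) : Letter := (l.1, -l.2)

/-- The letter with the same sign and the other generator. The two potential targets of `x` are
`l.val • x` and `l.swap.val • x` for `l = (0, x 1)`. -/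
def Letter.swap (l : Letter) : Letter := (1 - l.1, l.2)

/-- The letter as it occurs in the words of Mathlib's free group, where the sign is a `Bool`. -/
def Letter.code (l : Letter) : Fin 2 × Bool := (l.1, decide (l.2 = 1))

theorem Letter.flip_flip (l : Letter) : l.flip.flip = l := by simp [Letter.flip]

theorem Letter.swap_swap (l : Letter) : l.swap.swap = l := by simp [Letter.swap]

theorem Letter.swap_fst_ne (l : Letter) : l.swap.1 ≠ l.1 := by
  revert l; decide

theorem Letter.val_flip (l : Letter) : l.flip.val = l.val⁻¹ := by
  simp [Letter.val, Letter.flip]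

theorem Letter.code_injective : Function.Injective Letter.code := by decide

theorem Letter.code_flip (l : Letter) : l.flip.code = (l.code.1, !l.code.2) := by
  revert l; decide

theorem Letter.val_eq_mk (l : Letter) : l.val = FreeGroup.mk [l.code] := by
  obtain ⟨i, s⟩ := l
  rcases Int.units_eq_one_or s with rfl | rfl
  · simp [Letter.val, T, Letter.code, FreeGroup.of]
  · simp [Letter.val, T, Letter.code, FreeGroup.of, FreeGroup.inv_mk, FreeGroup.invRev]

/-- Left multiplication by a letter prepends this letter, unless the first letter cancels. -/
theorem toWord_val_mul {l : Letter} {g : F₂} (h : g.toWord.head? ≠ some l.flip.code) :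
    (l.val * g).toWord = l.code :: g.toWord := by
  have hmul : l.val * g = FreeGroup.mk (l.code :: g.toWord) := by
    conv_lhs => rw [← FreeGroup.mk_toWord (x := g), Letter.val_eq_mk, FreeGroup.mul_mk]
    rfl
  rw [hmul, FreeGroup.toWord_mk]
  apply FreeGroup.IsReduced.reduce_eq
  rw [Letter.code_flip] at h
  have hg : FreeGroup.IsReduced g.toWord := FreeGroup.isReduced_toWord
  cases hw : g.toWord with
  | nil => exact FreeGroup.IsReduced.singleton
  | cons b w =>
    rw [hw] at h hg
    refine List.isChain_cons_cons.2 ⟨fun h1 => ?_, hg⟩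
    by_contra h2
    refine h ?_
    rw [List.head?_cons, Option.some_inj]
    refine Prod.ext h1.symm ?_
    revert h2
    cases b.2 <;> cases l.code.2 <;> simp

theorem Letter.toWord_val (l : Letter) : l.val.toWord = [l.code] := by
  have := toWord_val_mul (l := l) (g := 1) (by simp)
  simpa using this

theorem Letter.val_injective : Function.Injective Letter.val := fun k l h =>
  Letter.code_injective (by simpa [Letter.toWord_val] using congrArg FreeGroup.toWord h)

/-! ### The separation words -/

theorem mem_shortWords_iff {g : F₂} : g ∈ shortWords ↔ ∃ l : Letter, g = l.swap.val * l.val⁻¹ := by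
  simp only [shortWords, Finset.mem_insert, Finset.mem_singleton]
  constructor
  · rintro (rfl | rfl | rfl | rfl)
    · exact ⟨(1, 1), by simp [Letter.swap, Letter.val]⟩
    · exact ⟨(1, -1), by simp [Letter.swap, Letter.val]⟩
    · exact ⟨(0, 1), by simp [Letter.swap, Letter.val]⟩
    · exact ⟨(0, -1), by simp [Letter.swap, Letter.val]⟩
  · rintro ⟨⟨i, s⟩, rfl⟩
    rcases Int.units_eq_one_or s with rfl | rfl <;> fin_cases i <;>
      simp [Letter.swap, Letter.val]

theorem Letter.swap_val_mul_mem (l : Letter) : l.swap.val * l.val⁻¹ ∈ shortWords :=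
  mem_shortWords_iff.2 ⟨l, rfl⟩

theorem inv_mem_shortWords {g : F₂} (h : g ∈ shortWords) : g⁻¹ ∈ shortWords := by
  obtain ⟨l, rfl⟩ := mem_shortWords_iff.1 h
  exact mem_shortWords_iff.2 ⟨l.swap, by rw [Letter.swap_swap]; group⟩

theorem one_notMem_shortWords : (1 : F₂) ∉ shortWords := by
  intro h
  obtain ⟨l, hl⟩ := mem_shortWords_iff.1 h
  have := Letter.val_injective (mul_inv_eq_one.1 hl.symm)
  exact l.swap_fst_ne (congrArg Prod.fst this)

theorem one_notMem_separationWords : (1 : F₂) ∉ separationWords := by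
  simp [separationWords, one_notMem_shortWords]

theorem mul_mem_separationWords {g h : F₂} (hg : g ∈ shortWords) (hh : h ∈ shortWords)
    (hne : g * h ≠ 1) : g * h ∈ separationWords :=
  Finset.mem_union_right _ (Finset.mem_erase.2 ⟨hne, Finset.mul_mem_mul hg hh⟩)

theorem inv_mem_separationWords {g : F₂} (h : g ∈ separationWords) : g⁻¹ ∈ separationWords := by
  rcases Finset.mem_union.1 h with h | h
  · exact Finset.mem_union_left _ (inv_mem_shortWords h)
  · obtain ⟨hne, h⟩ := Finset.mem_erase.1 h
    obtain ⟨a, ha, b, hb, rfl⟩ := Finset.mem_mul.1 h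
    rw [mul_inv_rev]
    exact mul_mem_separationWords (inv_mem_shortWords hb) (inv_mem_shortWords ha)
      (by rwa [← mul_inv_rev, Ne, inv_eq_one])

theorem card_separationWords_le : separationWords.card ≤ 16 := by
  decide

/-! ### The targets in terms of letters -/

theorem smul_apply (g : F₂) (x : Config) (h : F₂) : (g • x) h = x (g⁻¹ * h) := rfl

theorem target_eq (i : Fin 2) (x : Config) : target i x = Letter.val (i, x 1) • x := rfl

theorem smul_mem_freePart {x : Config} (hx : x ∈ freePart) (g : F₂) : g • x ∈ freePart := by
  intro h hh heq
  refine hx (g⁻¹ * h * g) (fun h1 => hh ?_) ?_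
  · have := congrArg (fun w => g * w * g⁻¹) h1
    simpa [mul_assoc] using this
  · rw [mul_smul, mul_smul, heq, inv_smul_smul]

theorem smul_injective_of_mem_freePart {x : Config} (hx : x ∈ freePart) {g h : F₂}
    (heq : g • x = h • x) : g = h := by
  by_contra hne
  exact hx (h⁻¹ * g) (fun h1 => hne (inv_mul_eq_one.1 h1).symm)
    (by rw [mul_smul, heq, inv_smul_smul])

theorem target_mem_freePart {x : Config} (hx : x ∈ freePart) (i : Fin 2) :
    target i x ∈ freePart := smul_mem_freePart hx _

/-- The two potential targets of a point differ by a short word. -/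
theorem exists_shortWord_smul_target {i j : Fin 2} (hij : i ≠ j) (x : Config) :
    ∃ g ∈ shortWords, target i x = g • target j x := by
  have hi : i = 1 - j := by revert i j; decide
  refine ⟨_, Letter.swap_val_mul_mem (j, x 1), ?_⟩
  rw [target_eq, target_eq, mul_smul, inv_smul_smul, hi]
  rfl

/-! ### The product measure and the shift -/

instance countable_freeGroup : Countable F₂ := FreeGroup.toWord_injective.countable

instance discreteMeasurableSpace_sign : DiscreteMeasurableSpace ℤˣ where
  forall_measurableSet s := ⟨Units.val '' s, .of_discrete,
    Set.preimage_image_eq s Units.val_injective⟩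

instance isProbabilityMeasure_coinMeasure : IsProbabilityMeasure coinMeasure := by
  unfold coinMeasure; infer_instance

theorem measurable_shift (g : F₂) : Measurable fun x : Config => g • x :=
  measurable_pi_lambda _ fun h => measurable_pi_apply (g⁻¹ * h)

theorem measurePreserving_shift (g : F₂) :
    MeasurePreserving (fun x : Config => g • x) coinMeasure coinMeasure :=
  ⟨measurable_shift g, Measure.map_infinitePi_infinitePi_of_inj (mul_right_injective g⁻¹)⟩

/-- A property that holds almost everywhere holds on almost every whole orbit. -/
theorem ae_forall_smul {p : Config → Prop} (h : ∀ᵐ x ∂coinMeasure, p x) :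
    ∀ᵐ x ∂coinMeasure, ∀ g : F₂, p (g • x) :=
  ae_all_iff.2 fun g => (measurePreserving_shift g).quasiMeasurePreserving.ae h

theorem coin_singleton (s : ℤˣ) : (PMF.uniformOfFintype ℤˣ).toMeasure {s} = 2⁻¹ := by
  rw [PMF.toMeasure_apply_singleton _ _ (.of_discrete)]
  simp

/-- Prescribing the coordinates in a finite set `s` has probability `2 ^ (-|s|)`. -/
theorem coinMeasure_cylinder (s : Finset F₂) (σ : F₂ → ℤˣ) :
    coinMeasure {x | ∀ g ∈ s, x g = σ g} = 2⁻¹ ^ s.card := by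
  have : {x : Config | ∀ g ∈ s, x g = σ g} = Set.pi s fun g => {σ g} := by
    ext x; simp [Set.mem_pi]
  rw [this, coinMeasure, Measure.infinitePi_pi _ (fun _ _ => .of_discrete)]
  rw [Finset.prod_congr rfl fun g _ => coin_singleton (σ g), Finset.prod_const]

/-- A configuration fixed by `g` is constant on the powers of `g`; these are infinitely many
independent coordinates. -/
theorem coinMeasure_fixed {g : F₂} (hg : g ≠ 1) : coinMeasure {x : Config | g • x = x} = 0 := by
  have hinj : Function.Injective fun n : ℕ => g ^ n := injective_pow_iff_not_isOfFinOrder.2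
    (not_isOfFinOrder_of_isMulTorsionFree hg)
  have key : ∀ N : ℕ, coinMeasure {x : Config | g • x = x} ≤ 2⁻¹ ^ N + 2⁻¹ ^ N := by
    intro N
    set s : Finset F₂ := (Finset.range N).image fun n => g ^ n with hs
    have hcard : s.card = N := by
      rw [hs, Finset.card_image_of_injective _ hinj, Finset.card_range]
    have hsub : {x : Config | g • x = x} ⊆
        {x | ∀ h ∈ s, x h = 1} ∪ {x | ∀ h ∈ s, x h = -1} := by
      intro x hx
      have hpow : ∀ n : ℕ, x (g ^ n) = x 1 := by
        intro n
        induction n with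
        | zero => simp
        | succ n ih =>
          have := congrFun (show g • x = x from hx) (g ^ (n + 1))
          rw [smul_apply, pow_succ', inv_mul_cancel_left, ih] at this
          rw [pow_succ', this]
      rcases Int.units_eq_one_or (x 1) with h1 | h1
      · left; simp [hs, hpow, h1]
      · right; simp [hs, hpow, h1]
    refine (measure_mono hsub).trans ((measure_union_le _ _).trans ?_)
    rw [coinMeasure_cylinder s fun _ => 1, coinMeasure_cylinder s fun _ => -1, hcard]
  have hlim : Filter.Tendsto (fun N : ℕ => (2⁻¹ : ℝ≥0∞) ^ N + 2⁻¹ ^ N) Filter.atTop (nhds (0 + 0)) :=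
    (ENNReal.tendsto_pow_atTop_nhds_zero_of_lt_one (by simp)).add
      (ENNReal.tendsto_pow_atTop_nhds_zero_of_lt_one (by simp))
  rw [add_zero] at hlim
  exact le_antisymm (ge_of_tendsto' hlim key) zero_le

theorem ae_mem_freePart : ∀ᵐ x ∂coinMeasure, x ∈ freePart := by
  refine ae_all_iff.2 fun g => ?_
  by_cases hg : g = 1
  · exact .of_forall fun x h => absurd hg h
  · have : ∀ᵐ x ∂coinMeasure, g • x ≠ x := by
      rw [ae_iff]; simpa using coinMeasure_fixed hg
    exact this.mono fun x hx _ => hx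

/-! ### Measurability -/

theorem measurable_eq_config {α : Type*} [MeasurableSpace α] {f g : α → Config}
    (hf : Measurable f) (hg : Measurable g) : MeasurableSet {a | f a = g a} := by
  simp only [funext_iff, Set.ofPred_forall]
  exact .iInter fun h => measurableSet_eq_fun ((measurable_pi_apply h).comp hf)
    ((measurable_pi_apply h).comp hg)

theorem measurableSet_freePart : MeasurableSet freePart := by
  simp only [freePart, Set.ofPred_forall]
  exact .iInter fun g => .iInter fun _ =>
    (measurable_eq_config (measurable_shift g) measurable_id).compl

theorem measurable_target (i : Fin 2) : Measurable (target i) := by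
  have h : ∀ s : ℤˣ, MeasurableSet {x : Config | x 1 = s} := fun s =>
    measurableSet_eq_fun (measurable_pi_apply (1 : F₂)) measurable_const
  have heq : target i = fun x : Config =>
      if x 1 = 1 then Letter.val (i, 1) • x else Letter.val (i, -1) • x := by
    funext x
    rw [target_eq]
    rcases Int.units_eq_one_or (x 1) with h1 | h1
    · simp [h1]
    · rw [h1, if_neg (by decide)]
  rw [heq]
  exact Measurable.ite (h 1) (measurable_shift _) (measurable_shift _)

/-! ### Events that depend on a set of coordinates -/

/-- The σ-algebra of the events that depend on the coordinates in `S` only. -/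
@[reducible]
def coordSigma (S : Set F₂) : MeasurableSpace Config :=
  ⨆ w ∈ S, MeasurableSpace.comap (fun x : Config => x w) inferInstance

theorem coordSigma_mono {S S' : Set F₂} (h : S ⊆ S') : coordSigma S ≤ coordSigma S' :=
  biSup_mono h

theorem coordSigma_le (S : Set F₂) : coordSigma S ≤ MeasurableSpace.pi :=
  iSup₂_le fun w _ => (measurable_pi_apply w).comap_le

theorem measurableSet_coord {S : Set F₂} {w : F₂} (hw : w ∈ S) (s : ℤˣ) :
    MeasurableSet[coordSigma S] {x : Config | x w = s} := by
  have hle : MeasurableSpace.comap (fun x : Config => x w) inferInstance ≤ coordSigma S :=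
    le_iSup₂ (f := fun w (_ : w ∈ S) => MeasurableSpace.comap (fun x : Config => x w) inferInstance)
      w hw
  exact hle _ ⟨{s}, .of_discrete, rfl⟩

theorem measurableSet_coordSigma_smul {S S' : Set F₂} {E : Set Config} (u : F₂)
    (hE : MeasurableSet[coordSigma S] E) (hS : ∀ w ∈ S, u⁻¹ * w ∈ S') :
    MeasurableSet[coordSigma S'] {x | u • x ∈ E} := by
  have h : coordSigma S ≤ (coordSigma S').map fun x : Config => u • x := by
    refine iSup₂_le fun w hw => ?_
    rintro _ ⟨t, -, rfl⟩
    have : (fun x : Config => u • x) ⁻¹' ((fun x : Config => x w) ⁻¹' t) =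
        ⋃ s ∈ t, {x : Config | x (u⁻¹ * w) = s} := by
      ext x; simp [smul_apply]
    change MeasurableSet[coordSigma S'] _
    rw [this]
    exact .biUnion (Set.to_countable _) fun s _ => measurableSet_coord (hS w hw) s
  exact h _ hE

/-- Events that depend on disjoint sets of coordinates are independent. -/
theorem coinMeasure_inter {S S' : Set F₂} (hS : Disjoint S S') {E E' : Set Config}
    (hE : MeasurableSet[coordSigma S] E) (hE' : MeasurableSet[coordSigma S'] E') :
    coinMeasure (E ∩ E') = coinMeasure E * coinMeasure E' := by
  have hind : ProbabilityTheory.iIndep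
      (fun w : F₂ => MeasurableSpace.comap (fun x : Config => x w) inferInstance) coinMeasure :=
    ProbabilityTheory.iIndepFun_infinitePi (X := fun (_ : F₂) (s : ℤˣ) => s)
      fun _ => measurable_id
  exact (ProbabilityTheory.Indep_iff _ _ _).1 (ProbabilityTheory.indep_iSup_of_disjoint
    (fun w => (measurable_pi_apply w).comap_le) hind hS) _ _ hE hE'

/-! ### Existence of an original colouring -/

/-- Two points of the free part that differ by a separation word differ in some coordinate, so
countably many measurable sets without such pairs cover the free part. -/
theorem exists_measurable_label : ∃ k : Config → ℕ, Measurable k ∧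
    ∀ x ∈ freePart, ∀ g ∈ separationWords, k (g • x) ≠ k x := by
  classical
  obtain ⟨e, he⟩ := exists_surjective_nat (separationWords → F₂ × ℤˣ)
  -- The `n`-th set prescribes, for every separation word `g`, a coordinate of `x` and a value there
  -- which `g • x` does not have. Points outside the free part belong to all sets.
  let p : Config → ℕ → Prop := fun x n => x ∉ freePart ∨
    ∀ g : separationWords, x (e n g).1 = (e n g).2 ∧ (g.1 • x) (e n g).1 ≠ (e n g).2
  have hp : ∀ x, ∃ n, p x n := by
    intro x
    by_cases hx : x ∈ freePart
    · have : ∀ g : separationWords, ∃ h, (g.1 • x) h ≠ x h := fun g =>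
        Function.ne_iff.1 (hx g.1 fun h => one_notMem_separationWords (h ▸ g.2))
      choose h hh using this
      obtain ⟨n, hn⟩ := he fun g => (h g, x (h g))
      exact ⟨n, Or.inr fun g => by rw [hn]; exact ⟨rfl, hh g⟩⟩
    · exact ⟨0, Or.inl hx⟩
  refine ⟨fun x => Nat.find (hp x), measurable_find hp fun n => ?_, fun x hx g hg heq => ?_⟩
  · have h1 : ∀ g : separationWords, MeasurableSet {x : Config | x (e n g).1 = (e n g).2} :=
      fun g => measurableSet_eq_fun (measurable_pi_apply _) measurable_const
    have h2 : ∀ g : separationWords,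
        MeasurableSet {x : Config | (g.1 • x) (e n g).1 ≠ (e n g).2} :=
      fun g => (measurableSet_eq_fun ((measurable_pi_apply _).comp (measurable_shift g.1))
        measurable_const).compl
    have : {x | p x n} = freePartᶜ ∪ ⋂ g : separationWords,
        ({x : Config | x (e n g).1 = (e n g).2} ∩ {x | (g.1 • x) (e n g).1 ≠ (e n g).2}) := by
      ext x; simp [p]
    rw [this]
    exact measurableSet_freePart.compl.union (.iInter fun g => (h1 g).inter (h2 g))
  · have hx1 := (Nat.find_spec (hp x)).resolve_left (not_not.2 hx) ⟨g, hg⟩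
    have hx2 := (Nat.find_spec (hp (g • x))).resolve_left
      (not_not.2 (smul_mem_freePart hx g)) ⟨g, hg⟩
    rw [show Nat.find (hp (g • x)) = Nat.find (hp x) from heq] at hx2
    exact hx1.2 hx2.1

theorem exists_notMem_range (b : separationWords → Fin 17) : ∃ i, ∀ g, b g ≠ i := by
  by_contra! h
  have h1 := Fintype.card_le_of_surjective b h
  rw [Fintype.card_fin, Fintype.card_coe] at h1
  exact absurd card_separationWords_le (by omega)

/-- A colour that is not used by any of the sixteen neighbours, when `b` gives their colours. -/
noncomputable def freshColour (b : separationWords → Fin 17) : Fin 17 :=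
  (exists_notMem_range b).choose

theorem freshColour_ne (b : separationWords → Fin 17) (g : separationWords) :
    freshColour b ≠ b g := ((exists_notMem_range b).choose_spec g).symm

/-- Greedy colouring along the label `k`: in step `n` all points of label `n` receive a colour
not used by their neighbours at that time. Before the first step all points have colour `0`. -/
noncomputable def greedyColouring (k : Config → ℕ) : ℕ → Config → Fin 17
  | 0, _ => 0
  | n + 1, x => if k x = n then freshColour fun g => greedyColouring k n (g.1 • x)
      else greedyColouring k n x

theorem measurable_greedyColouring {k : Config → ℕ} (hk : Measurable k) (n : ℕ) :
    Measurable (greedyColouring k n) := by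
  induction n with
  | zero => exact measurable_const
  | succ n ih =>
    refine Measurable.ite (hk (.of_discrete (s := {n}))) ?_ ih
    exact (Measurable.of_discrete (f := freshColour)).comp
      (measurable_pi_lambda _ fun g => ih.comp (measurable_shift g.1))

theorem greedyColouring_stable {k : Config → ℕ} {x : Config} {n : ℕ} (h : k x < n) :
    greedyColouring k n x = greedyColouring k (k x + 1) x := by
  induction n, h using Nat.le_induction with
  | base => rfl
  | succ n hn ih =>
    rw [← ih, greedyColouring, if_neg (by omega)]

theorem exists_isOriginalColouring : ∃ c₀ : Config → Fin 17, IsOriginalColouring c₀ := by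
  obtain ⟨k, hk, hsep⟩ := exists_measurable_label
  refine ⟨fun x => greedyColouring k (k x + 1) x, ?_, ?_⟩
  · have h : Measurable fun p : ℕ × Config => greedyColouring k (p.1 + 1) p.2 :=
      measurable_from_prod_countable_right fun n => measurable_greedyColouring hk (n + 1)
    exact h.comp (hk.prodMk measurable_id)
  · have key : ∀ x, ∀ g ∈ separationWords, k (g • x) < k x →
        greedyColouring k (k (g • x) + 1) (g • x) ≠ greedyColouring k (k x + 1) x := by
      intro x g hg hlt
      rw [greedyColouring.eq_2 k x (k x), if_pos rfl, ← greedyColouring_stable hlt]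
      exact (freshColour_ne (fun g : separationWords => greedyColouring k (k x) (g.1 • x))
        ⟨g, hg⟩).symm
    intro x hx g hg
    rcases lt_or_gt_of_ne (hsep x hx g hg) with h | h
    · exact key x g hg h
    · have := key (g • x) g⁻¹ (inv_mem_separationWords hg) (by rwa [inv_smul_smul])
      rw [inv_smul_smul] at this
      exact this.symm

/-! ### Injective arrow systems -/

/-- Choose a base point in every orbit. A free orbit is a tree, and at most one of the two potential
arrows at a point leads toward the base point. If all arrows lead away from it, then the source of
an arrow is determined by its target. -/
theorem exists_injOn_target :
    ∃ a : Config → Fin 2, Set.InjOn (fun x => target (a x) x) freePart := by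
  let base : Config → Config := fun x =>
    Quotient.out (Quotient.mk (MulAction.orbitRel F₂ Config) x)
  have hbase : ∀ x, ∃ g : F₂, g • base x = x := fun x =>
    (MulAction.orbitRel F₂ Config).symm
      (Quotient.mk_out (s := MulAction.orbitRel F₂ Config) x)
  have hbase_smul : ∀ (g : F₂) (x : Config), base (g • x) = base x := fun g x =>
    congrArg Quotient.out (Quotient.sound (s := MulAction.orbitRel F₂ Config) ⟨g, rfl⟩)
  choose w hw using hbase
  have hex : ∀ x, ∃ i : Fin 2, (w x).toWord.head? ≠ some (Letter.flip (i, x 1)).code := by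
    intro x
    by_contra! h
    have := Letter.code_injective (Option.some_injective _ ((h 0).symm.trans (h 1)))
    exact absurd (congrArg Prod.fst this) (by simp [Letter.flip])
  choose a ha using hex
  refine ⟨a, fun x hx y hy hxy => ?_⟩
  have hxy' : Letter.val (a x, x 1) • x = Letter.val (a y, y 1) • y := hxy
  have hb : base x = base y := by
    rw [← hbase_smul (Letter.val (a x, x 1)) x, hxy', hbase_smul]
  have hfree : base x ∈ freePart := by
    rw [← inv_smul_eq_iff.2 (hw x).symm]
    exact smul_mem_freePart hx _
  have hmul : Letter.val (a x, x 1) * w x = Letter.val (a y, y 1) * w y := by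
    refine smul_injective_of_mem_freePart hfree ?_
    rw [mul_smul, mul_smul, hw x, hb, hw y, hxy']
  have hword := congrArg FreeGroup.toWord hmul
  rw [toWord_val_mul (ha x), toWord_val_mul (ha y)] at hword
  have hwxy : w x = w y := FreeGroup.toWord_injective (List.cons.inj hword).2
  rw [← hw x, ← hw y, hb, hwxy]

/-- Translate the arrows with letter `l`, that is, the set of their sources, by `k⁻¹ * l` for a fixed
letter `k`. The translates are disjoint and have total measure `1`, but they avoid the points `y`
for which no arrow could be directed to `k • y`, and these have measure `1 / 16`. -/
theorem not_measurable_of_isInjectiveArrowSystem {ι : Type*} {D : ι → Config → Config}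
    {𝒜 : Set (Set Config)} {μ : AddContent ℝ≥0∞ 𝒜} (h : IsInvariantExtension coinMeasure 𝒜 μ D)
    (hD : ∀ k l : Letter, k ≠ l → ∃ d, D d = fun x => (k.val⁻¹ * l.val) • x)
    {a : Config → Fin 2} (ha : IsInjectiveArrowSystem coinMeasure a)
    (hmeas : ∀ i, a ⁻¹' {i} ∈ 𝒜) : False := by
  have hring := h.isSetAlgebra.isSetRing
  obtain ⟨N, hN, hinj⟩ := ha
  obtain ⟨M, hNM, hM, hM0⟩ := exists_measurable_superset_of_null (mem_ae_iff.1 hN)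
  have hMN : Mᶜ ⊆ N := Set.compl_subset_comm.1 hNM
  have hM1 : coinMeasure Mᶜ = 1 := (prob_compl_eq_one_iff hM).2 hM0
  let A : Letter → Set Config := fun l => Mᶜ ∩ (a ⁻¹' {l.1} ∩ {x | x 1 = l.2})
  have hA : ∀ l, A l ∈ 𝒜 := fun l =>
    hring.inter_mem (h.measurableSet_mem _ hM.compl) (hring.inter_mem (hmeas _)
      (h.measurableSet_mem _ (measurableSet_eq_fun (measurable_pi_apply _) measurable_const)))
  have hAeq : ∀ l x, x ∈ A l → l = (a x, x 1) := fun l x hx =>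
    Prod.ext hx.2.1.symm hx.2.2.symm
  have hAdisj : Pairwise (Function.onFun Disjoint A) := fun k l hkl =>
    Set.disjoint_left.2 fun x hk hl => hkl ((hAeq k x hk).trans (hAeq l x hl).symm)
  have hAU : ⋃ l, A l = Mᶜ := by
    ext x
    simp only [Set.mem_iUnion]
    exact ⟨fun ⟨l, hl⟩ => hl.1, fun hx => ⟨(a x, x 1), hx, rfl, rfl⟩⟩
  let k : Letter := (0, 1)
  let B : Letter → Set Config := fun l => (fun x => (l.val⁻¹ * k.val) • x) ⁻¹' A l
  have hB : ∀ l, B l ∈ 𝒜 ∧ μ (B l) = μ (A l) := by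
    intro l
    by_cases hlk : l = k
    · have : B l = A l := by
        ext x; simp [B, hlk]
      rw [this]
      exact ⟨hA l, rfl⟩
    · obtain ⟨d, hd⟩ := hD l k hlk
      have : B l = D d ⁻¹' A l := by rw [hd]
      rw [this]
      exact ⟨h.preimage_mem d _ (hA l), h.preserving d _ (hA l)⟩
  have hBdisj : Pairwise (Function.onFun Disjoint B) := by
    intro l l' hne
    refine Set.disjoint_left.2 fun y hy hy' => hne ?_
    -- A point `y` of `B l` comes from an arrow directed to `k.val • y`, whatever `l` is.
    have htarget : ∀ l, y ∈ B l →
        target (a ((l.val⁻¹ * k.val) • y)) ((l.val⁻¹ * k.val) • y) = k.val • y := by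
      intro l hl
      rw [target_eq, ← hAeq l _ hl, mul_smul, smul_inv_smul]
    have := hinj (hMN hy.1) (hMN hy'.1) ((htarget l hy).trans (htarget l' hy').symm)
    rw [hAeq l _ hy, hAeq l' _ hy', this]
  -- The points without potential incoming arrows: `z l.val = -l.2` for every letter `l`. The
  -- letter is recovered from its group element, which makes this a cylinder set.
  let Z₀ : Set Config := {z | ∀ g ∈ Finset.univ.image Letter.val, z g =
    -(Function.invFun Letter.val g).2}
  let Z : Set Config := (fun x => k.val • x) ⁻¹' Z₀
  have hZ₀ : MeasurableSet Z₀ := by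
    simp only [Z₀, Set.ofPred_forall]
    exact .iInter fun g => .iInter fun _ =>
      measurableSet_eq_fun (measurable_pi_apply g) measurable_const
  have hZ : MeasurableSet Z := measurable_shift _ hZ₀
  have hZpos : coinMeasure Z ≠ 0 := by
    rw [(measurePreserving_shift _).measure_preimage hZ₀.nullMeasurableSet, coinMeasure_cylinder]
    exact pow_ne_zero _ (by simp)
  have hBZ : Disjoint (⋃ l, B l) Z := by
    refine Set.disjoint_left.2 fun y hy hyZ => ?_
    obtain ⟨l, hl⟩ := Set.mem_iUnion.1 hy
    have h1 : (k.val • y) l.val = -l.2 := by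
      have := hyZ l.val (Finset.mem_image_of_mem _ (Finset.mem_univ l))
      rwa [Function.leftInverse_invFun Letter.val_injective l] at this
    have h2 : (l.val⁻¹ • k.val • y) 1 = l.2 := by
      rw [← mul_smul]; exact hl.2.2
    rw [smul_apply, inv_inv, mul_one, h1] at h2
    exact units_ne_neg_self _ h2.symm
  have hBU : ⋃ l, B l ∈ 𝒜 := by
    simpa using hring.biUnion_mem Finset.univ fun l _ => (hB l).1
  have hsum : μ (⋃ l, B l) = 1 := by
    rw [addContent_iUnion (fun l => (hB l).1) hBdisj hBU]
    simp only [(hB _).2]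
    rw [← addContent_iUnion hA hAdisj (hAU ▸ h.measurableSet_mem _ hM.compl), hAU,
      h.extends_measure _ hM.compl, hM1]
  have hle : μ ((⋃ l, B l) ∪ Z) ≤ μ Set.univ :=
    addContent_mono hring.isSetSemiring (hring.union_mem hBU (h.measurableSet_mem _ hZ))
      h.isSetAlgebra.univ_mem (Set.subset_univ _)
  rw [addContent_union hring hBU (h.measurableSet_mem _ hZ) hBZ, hsum,
    h.extends_measure _ hZ, h.extends_measure _ .univ, measure_univ] at hle
  refine hZpos ?_
  exact le_zero_iff.1 ((ENNReal.add_le_add_iff_left ENNReal.one_ne_top).1 (hle.trans_eq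
    (add_zero 1).symm))

/-! ### Proper list colouring and injective arrow systems -/

theorem IsOriginalColouring.ne_of_mem_shortWords {c₀ : Config → Fin 17}
    (hc₀ : IsOriginalColouring c₀) {x : Config} (hx : x ∈ freePart) {g : F₂}
    (hg : g ∈ shortWords) : c₀ (g • x) ≠ c₀ x :=
  hc₀.2 x hx g (Finset.mem_union_left _ hg)

theorem IsOriginalColouring.target_injective {c₀ : Config → Fin 17}
    (hc₀ : IsOriginalColouring c₀) {x : Config} (hx : x ∈ freePart) :
    Function.Injective fun i => c₀ (target i x) := by
  intro i j hij
  by_contra hne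
  obtain ⟨g, hg, hgx⟩ := exists_shortWord_smul_target hne x
  refine hc₀.ne_of_mem_shortWords (target_mem_freePart hx j) hg ?_
  rw [← hgx]
  exact hij

theorem card_colourList {c₀ : Config → Fin 17} (hc₀ : IsOriginalColouring c₀) {x : Config}
    (hx : x ∈ freePart) : (colourList c₀ x).card = 2 := by
  rw [colourList, Finset.card_image_of_injective _ (hc₀.target_injective hx)]
  simp

theorem mem_colourList_iff {c₀ : Config → Fin 17} {x : Config} {k : Fin 17} :
    k ∈ colourList c₀ x ↔ ∃ i, k = c₀ (target i x) := by
  simp [colourList, eq_comm]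

/-- If arrows from `x` and `y` could be directed to a common point, then any two distinct potential
targets of `x` and of `y` have different original colours. -/
theorem IsOriginalColouring.target_ne {c₀ : Config → Fin 17} (hc₀ : IsOriginalColouring c₀)
    {x y : Config} (hy : y ∈ freePart) {i j i' j' : Fin 2} (hz : target i x = target j y)
    (hne : target i' x ≠ target j' y) : c₀ (target i' x) ≠ c₀ (target j' y) := by
  by_cases hi : i' = i
  · subst hi
    by_cases hj : j' = j
    · subst hj
      exact absurd hz hne
    · obtain ⟨g, hg, hgy⟩ := exists_shortWord_smul_target (Ne.symm hj) y
      rw [hz, hgy]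
      exact hc₀.ne_of_mem_shortWords (target_mem_freePart hy j') hg
  · obtain ⟨g, hg, hgx⟩ := exists_shortWord_smul_target hi x
    by_cases hj : j' = j
    · subst hj
      rw [hgx, hz]
      exact hc₀.ne_of_mem_shortWords (target_mem_freePart hy j') hg
    · obtain ⟨g', hg', hgy⟩ := exists_shortWord_smul_target (Ne.symm hj) y
      have heq : target i' x = (g * g') • target j' y := by rw [hgx, hz, hgy, mul_smul]
      rw [heq] at hne ⊢
      refine hc₀.2 _ (target_mem_freePart hy j') _ (mul_mem_separationWords hg hg' fun h => ?_)
      exact hne (by rw [h, one_smul])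

/-- Colouring every point with the original colour of the end of its arrow is a proper list
colouring, if the arrow system is injective. -/
theorem satisfies_listRule_of_isInjectiveArrowSystem {c₀ : Config → Fin 17}
    (hc₀ : IsOriginalColouring c₀) {a : Config → Fin 2}
    (ha : IsInjectiveArrowSystem coinMeasure a) :
    (listRule c₀).Satisfies coinMeasure fun x => c₀ (target (a x) x) := by
  obtain ⟨N, hN, hinj⟩ := ha
  rw [listRule_satisfies_iff]
  filter_upwards [ae_forall_smul hN] with x hx
  refine ⟨mem_colourList_iff.2 ⟨_, rfl⟩, fun y hxy => ?_⟩
  obtain ⟨p, hp⟩ := secondaryGraph_adj_desc c₀ hxy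
  have hyN : y ∈ N := hp ▸ hx _
  have hxN : x ∈ N := by simpa using hx 1
  obtain ⟨hne, -, hy, z, ⟨i, hi⟩, ⟨j, hj⟩⟩ := hxy
  exact hc₀.target_ne hy (hi.symm.trans hj) fun h => hne (hinj hxN hyN h)

open Classical in
/-- The arrow system that a list colouring encodes: the arrow is directed to the potential target
whose original colour is the colour of the point. -/
noncomputable def arrowOf (c₀ c : Config → Fin 17) (x : Config) : Fin 2 :=
  if c x = c₀ (target 0 x) then 0 else 1

theorem eq_iff_eq_arrowOf {c₀ c : Config → Fin 17} (hc₀ : IsOriginalColouring c₀) {x : Config}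
    (hx : x ∈ freePart) (hc : c x ∈ colourList c₀ x) (i : Fin 2) :
    c x = c₀ (target i x) ↔ i = arrowOf c₀ c x := by
  have h := (hc₀.target_injective hx).ne (zero_ne_one (α := Fin 2))
  obtain ⟨j, hj⟩ := mem_colourList_iff.1 hc
  have harrow : j = arrowOf c₀ c x := by
    revert j
    rw [Fin.forall_fin_two, arrowOf]
    refine ⟨fun hj => (if_pos hj).symm, fun hj => (if_neg ?_).symm⟩
    rw [hj]
    exact h.symm
  rw [← harrow, hj]
  exact ⟨fun h' => (hc₀.target_injective hx h').symm, fun h' => h' ▸ rfl⟩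

theorem isInjectiveArrowSystem_arrowOf {c₀ c : Config → Fin 17} (hc₀ : IsOriginalColouring c₀)
    (hc : (listRule c₀).Satisfies coinMeasure c) :
    IsInjectiveArrowSystem coinMeasure (arrowOf c₀ c) := by
  rw [listRule_satisfies_iff] at hc
  refine ⟨_, hc.and ae_mem_freePart, fun x hx y hy hxy => ?_⟩
  by_contra hne
  refine hx.1.2 y ⟨hne, hx.2, hy.2, _, ⟨_, rfl⟩, ⟨_, hxy⟩⟩ ?_
  rw [(eq_iff_eq_arrowOf hc₀ hx.2 hx.1.1 _).2 rfl, (eq_iff_eq_arrowOf hc₀ hy.2 hy.1.1 _).2 rfl]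
  exact congrArg c₀ hxy

theorem ae_eq_iff_eq_arrowOf {c₀ c : Config → Fin 17} (hc₀ : IsOriginalColouring c₀)
    (hc : (listRule c₀).Satisfies coinMeasure c) :
    ∀ᵐ x ∂coinMeasure, ∀ i, c x = c₀ (target i x) ↔ i = arrowOf c₀ c x := by
  filter_upwards [hc, ae_mem_freePart] with x hx hfree i
  exact eq_iff_eq_arrowOf hc₀ hfree hx.1 i

theorem arrowOf_preimage_mem {c₀ c : Config → Fin 17} (hc₀ : IsOriginalColouring c₀)
    {𝒜 : Set (Set Config)} (h𝒜 : IsSetAlgebra 𝒜) (hmeas : ∀ S, MeasurableSet S → S ∈ 𝒜)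
    (hc : ∀ k, c ⁻¹' {k} ∈ 𝒜) (i : Fin 2) : arrowOf c₀ c ⁻¹' {i} ∈ 𝒜 := by
  have h0 : arrowOf c₀ c ⁻¹' {0} ∈ 𝒜 := by
    have : arrowOf c₀ c ⁻¹' {0} =
        ⋃ k ∈ Finset.univ, c ⁻¹' {k} ∩ (fun x => c₀ (target 0 x)) ⁻¹' {k} := by
      ext x; simp [arrowOf, eq_comm]
    rw [this]
    exact h𝒜.isSetRing.biUnion_mem _ fun k _ => h𝒜.isSetRing.inter_mem (hc k)
      (hmeas _ ((hc₀.1.comp (measurable_target 0)) (.of_discrete)))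
  revert i
  rw [Fin.forall_fin_two]
  refine ⟨h0, ?_⟩
  have : arrowOf c₀ c ⁻¹' {1} = (arrowOf c₀ c ⁻¹' {0})ᶜ := by
    ext x; simp [arrowOf]
  exact this ▸ h𝒜.compl_mem h0

/-! ### Proper list colouring as a paradoxical colouring rule -/

theorem measurableSet_adj (g : F₂) : MeasurableSet {x | secondaryGraph.Adj x (g • x)} := by
  have : {x | secondaryGraph.Adj x (g • x)} =
      {x | x = g • x}ᶜ ∩ (freePart ∩ ((fun x => g • x) ⁻¹' freePart ∩
        ⋃ i, ⋃ j, {x | target i x = target j (g • x)})) := by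
    ext x
    simp only [secondaryGraph, CanPoint, Set.mem_ofPred_eq, Set.mem_inter_iff, Set.mem_compl_iff,
      Set.mem_preimage, Set.mem_iUnion]
    refine and_congr_right fun _ => and_congr_right fun _ => and_congr_right fun _ => ?_
    exact ⟨fun ⟨z, ⟨i, hi⟩, j, hj⟩ => ⟨i, j, hi.symm.trans hj⟩,
      fun ⟨i, j, h⟩ => ⟨_, ⟨i, rfl⟩, j, h⟩⟩
  rw [this]
  exact (measurable_eq_config measurable_id (measurable_shift g)).compl.inter
    (measurableSet_freePart.inter (((measurable_shift g) measurableSet_freePart).inter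
      (.iUnion fun i => .iUnion fun j => measurable_eq_config (measurable_target i)
        ((measurable_target j).comp (measurable_shift g)))))

theorem inv_val_mul_val_ne_one (p : LetterPair) : p.1.2.val⁻¹ * p.1.1.val ≠ 1 := fun h =>
  p.2 (Letter.val_injective (inv_mul_eq_one.1 h).symm)

theorem isColouringRule_listRule {c₀ : Config → Fin 17} (hc₀ : IsOriginalColouring c₀) :
    (listRule c₀).IsColouringRule coinMeasure where
  measurePreserving p := measurePreserving_shift _
  irreflexive := ae_mem_freePart.mono fun x hx p => hx _ (inv_val_mul_val_ne_one p)
  measurableSet_graph := by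
    let r : NullMeasurableSpace Config coinMeasure → Config := fun x => x
    have hr : Measurable r := fun (s : Set Config) hs =>
      (MeasurableSet.nullMeasurableSet hs : NullMeasurableSet s coinMeasure)
    let q : Fin 17 × (NullMeasurableSpace Config coinMeasure × (LetterPair → Fin 17)) → Config :=
      fun p => r p.2.1
    have hq : Measurable q := hr.comp (measurable_fst.comp measurable_snd)
    have : {p : Fin 17 × (NullMeasurableSpace Config coinMeasure × (LetterPair → Fin 17)) |
          p.1 ∈ (listRule c₀).F p.2.1 p.2.2} =
        (⋃ i, {p | p.1 = c₀ (target i (q p))}) ∩ ⋂ d : LetterPair,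
          ((q ⁻¹' {x | secondaryGraph.Adj x ((d.1.2.val⁻¹ * d.1.1.val) • x)})ᶜ ∪
            {p | p.1 = p.2.2 d}ᶜ) := by
      ext p
      simp only [Set.mem_inter_iff, Set.mem_iUnion, Set.mem_iInter, Set.mem_union,
        Set.mem_compl_iff, Set.mem_preimage, Set.mem_ofPred_eq, ← imp_iff_not_or]
      exact and_congr_left fun _ => mem_colourList_iff
    rw [this]
    refine .inter (.iUnion fun i => measurableSet_eq_fun measurable_fst
      (hc₀.1.comp ((measurable_target i).comp hq))) (.iInter fun d => .union ?_ ?_)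
    · exact (hq (measurableSet_adj _)).compl
    · have hd : Measurable fun b : LetterPair → Fin 17 => b d := measurable_pi_apply d
      exact (measurableSet_eq_fun measurable_fst
        (hd.comp (measurable_snd.comp measurable_snd))).compl

theorem isParadoxical_listRule {c₀ : Config → Fin 17} (hc₀ : IsOriginalColouring c₀) :
    (listRule c₀).IsParadoxical coinMeasure := by
  refine ⟨?_, ?_⟩
  · obtain ⟨a, ha⟩ := exists_injOn_target
    exact ⟨_, satisfies_listRule_of_isInjectiveArrowSystem hc₀ ⟨_, ae_mem_freePart, ha⟩⟩
  · rintro 𝒜 μ hμ ⟨c, hc, hmeas⟩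
    exact not_measurable_of_isInjectiveArrowSystem hμ
      (fun k l hkl => ⟨⟨(l, k), hkl.symm⟩, rfl⟩) (isInjectiveArrowSystem_arrowOf hc₀ hc)
      (arrowOf_preimage_mem hc₀ hμ.isSetAlgebra hμ.measurableSet_mem fun k => hmeas _ (.of_discrete))

/-! ### Binary trees of potential arrows -/

/-- Consider the graph on the configurations in which every `x` is an edge between its two potential
targets. If the letter `k` satisfies `y k.val = k.2`, then `k.val⁻¹ • y` is such an edge at `y`, and
its other end is `(k.swap.val * k.val⁻¹) • y`. This is the event that `y` has the edge `k` and that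
the other end, which has this edge as its edge `k.swap`, belongs to `S k.swap`. -/
def edgeEvent (S : Letter → Set Config) (k : Letter) : Set Config :=
  {y | y k.val = k.2 ∧ (k.swap.val * k.val⁻¹) • y ∈ S k.swap}

/-- The event that `y` is the root of a binary tree of depth `n` that does not use the edge `l`. -/
def branching : ℕ → Letter → Set Config
  | 0, _ => Set.univ
  | n + 1, l => {y | ∃ s : Finset Letter, s.card = 2 ∧ l ∉ s ∧ ∀ k ∈ s, y ∈ edgeEvent (branching n) k}

/-- The group elements whose reduced word starts with the letter `k`. -/
def startingWith (k : Letter) : Set F₂ := {w | w.toWord.head? = some k.code}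

theorem disjoint_startingWith {k l : Letter} (h : k ≠ l) :
    Disjoint (startingWith k) (startingWith l) :=
  Set.disjoint_left.2 fun _ hk hl =>
    h (Letter.code_injective (Option.some_injective _ (hk.symm.trans hl)))

theorem mul_mem_startingWith {k m : Letter} (hm : m ≠ k.swap) {w : F₂} (hw : w ∈ startingWith m) :
    (k.swap.val * k.val⁻¹)⁻¹ * w ∈ startingWith k \ {k.val} := by
  have h1 : (k.swap.flip.val * w).toWord = k.swap.flip.code :: w.toWord := by
    refine toWord_val_mul fun h => hm ?_
    rw [Letter.flip_flip] at h
    exact Letter.code_injective (Option.some_injective _ (hw.symm.trans h))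
  have h2 : (k.val * (k.swap.flip.val * w)).toWord = k.code :: k.swap.flip.code :: w.toWord := by
    rw [toWord_val_mul, h1]
    rw [h1, List.head?_cons]
    intro h
    have h' : k.swap.flip.code.1 = k.flip.code.1 := congrArg Prod.fst (Option.some.inj h)
    exact k.swap_fst_ne h'
  have h3 : (k.swap.val * k.val⁻¹)⁻¹ * w = k.val * (k.swap.flip.val * w) := by
    rw [Letter.val_flip]; group
  rw [h3]
  refine ⟨by rw [startingWith, Set.mem_ofPred_eq, h2, List.head?_cons], fun h => ?_⟩
  have := congrArg FreeGroup.toWord (Set.mem_singleton_iff.1 h)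
  rw [h2, Letter.toWord_val] at this
  simp at this

theorem measurableSet_smul_preimage {S : Letter → Set Config} {k : Letter}
    (hS : MeasurableSet[coordSigma (⋃ m ≠ k.swap, startingWith m)] (S k.swap)) :
    MeasurableSet[coordSigma (startingWith k \ {k.val})]
      {y | (k.swap.val * k.val⁻¹) • y ∈ S k.swap} := by
  refine measurableSet_coordSigma_smul _ hS fun w hw => ?_
  simp only [Set.mem_iUnion] at hw
  obtain ⟨m, hm, hw⟩ := hw
  exact mul_mem_startingWith hm hw

theorem measurableSet_edgeEvent {S : Letter → Set Config} {k : Letter}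
    (hS : MeasurableSet[coordSigma (⋃ m ≠ k.swap, startingWith m)] (S k.swap)) :
    MeasurableSet[coordSigma (startingWith k)] (edgeEvent S k) := by
  refine MeasurableSet.inter (measurableSet_coord ?_ _)
    (coordSigma_mono Set.sdiff_subset _ (measurableSet_smul_preimage hS))
  simp [startingWith, Letter.toWord_val]

theorem measurableSet_branching (n : ℕ) (l : Letter) :
    MeasurableSet[coordSigma (⋃ m ≠ l, startingWith m)] (branching n l) := by
  induction n generalizing l with
  | zero => exact MeasurableSet.univ
  | succ n ih =>
    have : branching (n + 1) l =
        ⋃ s ∈ {s : Finset Letter | s.card = 2 ∧ l ∉ s}, ⋂ k ∈ s, edgeEvent (branching n) k := by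
      ext y
      simp only [branching, Set.mem_iUnion, Set.mem_iInter, Set.mem_ofPred_eq, exists_prop, and_assoc]
    rw [this]
    refine .biUnion (Set.to_countable _) fun s hs => .biInter (Set.to_countable _) fun k hk => ?_
    refine coordSigma_mono ?_ _ (measurableSet_edgeEvent (ih k.swap))
    exact Set.subset_biUnion_of_mem (u := startingWith)
      (show k ∈ {m | m ≠ l} from fun h => hs.2 (h ▸ hk))

theorem coinMeasure_edgeEvent (n : ℕ) (k : Letter) :
    coinMeasure (edgeEvent (branching n) k) = 2⁻¹ * coinMeasure (branching n k.swap) := by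
  have hB := measurableSet_branching n k.swap
  have hshift : coinMeasure {y | (k.swap.val * k.val⁻¹) • y ∈ branching n k.swap} =
      coinMeasure (branching n k.swap) :=
    (measurePreserving_shift (k.swap.val * k.val⁻¹)).measure_preimage
      (coordSigma_le _ _ hB).nullMeasurableSet
  have hdisj : Disjoint {k.val} (startingWith k \ {k.val}) := Set.disjoint_sdiff_right
  have hcoord : coinMeasure {y : Config | y k.val = k.2} = 2⁻¹ := by
    simpa using coinMeasure_cylinder {k.val} fun _ => k.2
  have hmeas : MeasurableSet[coordSigma {k.val}] {y : Config | y k.val = k.2} :=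
    measurableSet_coord (Set.mem_singleton _) _
  have hinter := coinMeasure_inter hdisj hmeas (measurableSet_smul_preimage hB)
  rw [hcoord, hshift] at hinter
  exact hinter

/-- There are three pairs of edges other than `l`, and the events for the two edges of a pair are
independent, each of probability at most half that of a binary tree of depth `n`. -/
theorem coinMeasure_branching_le (n : ℕ) (l : Letter) :
    coinMeasure (branching n l) ≤ (3 * 4⁻¹) ^ n := by
  induction n generalizing l with
  | zero => simpa using prob_le_one
  | succ n ih =>
    set q : ℝ≥0∞ := (3 * 4⁻¹) ^ n with hq
    have hq1 : q ≤ 1 := by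
      refine pow_le_one₀ zero_le ?_
      rw [← div_eq_mul_inv]
      exact ENNReal.div_le_of_le_mul (by norm_num)
    have hsub : branching (n + 1) l ⊆ ⋃ s ∈ Finset.powersetCard 2 (Finset.univ.erase l),
        ⋂ k ∈ s, edgeEvent (branching n) k := by
      rintro y ⟨s, hs, hl, hy⟩
      refine Set.mem_biUnion (Finset.mem_coe.2 (Finset.mem_powersetCard.2 ⟨?_, hs⟩))
        (Set.mem_iInter₂.2 hy)
      exact fun k hk => Finset.mem_erase.2 ⟨fun h => hl (h ▸ hk), Finset.mem_univ k⟩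
    have hpair : ∀ s ∈ Finset.powersetCard 2 (Finset.univ.erase l),
        coinMeasure (⋂ k ∈ s, edgeEvent (branching n) k) ≤ 4⁻¹ * q := by
      intro s hs
      obtain ⟨k, k', hne, rfl⟩ := Finset.card_eq_two.1 (Finset.mem_powersetCard.1 hs).2
      have h4 : (2⁻¹ : ℝ≥0∞) * 2⁻¹ = 4⁻¹ := by
        rw [← ENNReal.mul_inv (by simp) (by simp)]; norm_num
      simp only [Finset.mem_insert, Finset.mem_singleton, Set.iInter_iInter_eq_or_left,
        Set.iInter_iInter_eq_left]
      rw [coinMeasure_inter (disjoint_startingWith hne)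
        (measurableSet_edgeEvent (measurableSet_branching n _))
        (measurableSet_edgeEvent (measurableSet_branching n _)), coinMeasure_edgeEvent,
        coinMeasure_edgeEvent, mul_mul_mul_comm, h4]
      gcongr
      -- One of the two factors `q` suffices for exponential decay.
      calc _ ≤ q * 1 := mul_le_mul' (ih _) prob_le_one
        _ = q := mul_one q
    calc coinMeasure (branching (n + 1) l)
        ≤ ∑ s ∈ Finset.powersetCard 2 (Finset.univ.erase l),
          coinMeasure (⋂ k ∈ s, edgeEvent (branching n) k) :=
          (measure_mono hsub).trans (measure_biUnion_finset_le _ _)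
      _ ≤ (Finset.powersetCard 2 (Finset.univ.erase l)).card • (4⁻¹ * q) :=
          Finset.sum_le_card_nsmul _ _ _ hpair
      _ = (3 * 4⁻¹) ^ (n + 1) := by
          have hcard : (Finset.univ.erase l).card = 3 := by
            rw [Finset.card_erase_of_mem (Finset.mem_univ l)]; rfl
          rw [Finset.card_powersetCard, hcard, pow_succ', ← hq, mul_assoc]
          simp [Nat.choose]

theorem ae_exists_notMem_branching :
    ∀ᵐ x ∂coinMeasure, ∀ l, ∃ n, x ∉ branching n l := by
  refine ae_all_iff.2 fun l => ?_
  have hlim : Filter.Tendsto (fun n : ℕ => (3 * 4⁻¹ : ℝ≥0∞) ^ n) Filter.atTop (nhds 0) := by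
    refine ENNReal.tendsto_pow_atTop_nhds_zero_of_lt_one ?_
    rw [← div_eq_mul_inv]
    exact ENNReal.div_lt_of_lt_mul (by norm_num)
  refine measure_mono_null (t := ⋂ n, branching n l) (fun x hx => ?_)
    (le_antisymm (ge_of_tendsto' hlim fun n =>
      (measure_mono (Set.iInter_subset _ n)).trans (coinMeasure_branching_le n l)) zero_le)
  simpa using hx

/-! ### The fundamental rule leaves no crowded points -/

/-- The colouring `c` satisfies the fundamental rule on the whole orbit of `x`. -/
def SatisfiesOnOrbit (c : Config → Fin 2 × Bool) (x : Config) : Prop :=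
  ∀ g : F₂, c (g • x) ∈ fundamentalRule.F (g • x) fun l => c (fundamentalRule.desc l (g • x))

theorem SatisfiesOnOrbit.smul {c : Config → Fin 2 × Bool} {x : Config}
    (h : SatisfiesOnOrbit c x) (g : F₂) : SatisfiesOnOrbit c (g • x) := fun g' => by
  rw [← mul_smul]; exact h (g' * g)

/-- The arrow of the edge `k` at `y` is directed toward `y`. -/
def IncomingEdge (c : Config → Fin 2 × Bool) (y : Config) (k : Letter) : Prop :=
  Incoming y (fun l => c (fundamentalRule.desc l y)) k.flip

theorem incomingEdge_iff {c : Config → Fin 2 × Bool} {y : Config} {k : Letter} :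
    IncomingEdge c y k ↔ (k.val⁻¹ • y) 1 = k.2 ∧ (c (k.val⁻¹ • y)).1 = k.1 := by
  have h : IncomingEdge c y k ↔
      (k.flip.val • y) 1 = - -k.2 ∧ (c (k.flip.val • y)).1 = k.1 := Iff.rfl
  rw [h, Letter.val_flip, neg_neg]

theorem SatisfiesOnOrbit.crowded_iff {c : Config → Fin 2 × Bool} {y : Config}
    (h : SatisfiesOnOrbit c y) :
    (c y).2 = true ↔ ∃ k k', k ≠ k' ∧ IncomingEdge c y k ∧ IncomingEdge c y k' := by
  have h2 := (h 1).2
  rw [one_smul] at h2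
  rw [h2, Nat.succ_le_iff, Set.one_lt_ncard_iff (Set.toFinite _)]
  constructor
  · rintro ⟨l, l', hl, hl', hne⟩
    refine ⟨l.flip, l'.flip, fun h => hne ?_, ?_, ?_⟩
    · rw [← l.flip_flip, h, l'.flip_flip]
    · rwa [IncomingEdge, Letter.flip_flip]
    · rwa [IncomingEdge, Letter.flip_flip]
  · rintro ⟨k, k', hne, hk, hk'⟩
    refine ⟨k.flip, k'.flip, hk, hk', fun h => hne ?_⟩
    rw [← k.flip_flip, h, k'.flip_flip]

/-- If an arrow is directed to a crowded point, then the other choice was crowded as well. -/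
theorem SatisfiesOnOrbit.crowded_other_end {c : Config → Fin 2 × Bool} {y : Config}
    (h : SatisfiesOnOrbit c y) (hy : (c y).2 = true) {k : Letter} (hk : IncomingEdge c y k) :
    (c ((k.swap.val * k.val⁻¹) • y)).2 = true ∧
      ¬ IncomingEdge c ((k.swap.val * k.val⁻¹) • y) k.swap := by
  obtain ⟨h1, h2⟩ := incomingEdge_iff.1 hk
  have hrule : (∃ j : Fin 2, (c (Letter.val (j, (k.val⁻¹ • y) 1) • k.val⁻¹ • y)).2 = false) →
      (c (Letter.val ((c (k.val⁻¹ • y)).1, (k.val⁻¹ • y) 1) • k.val⁻¹ • y)).2 = false :=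
    (h k.val⁻¹).1
  rw [h1, h2] at hrule
  have hk1 : Letter.val (k.1, k.2) • k.val⁻¹ • y = y := smul_inv_smul k.val y
  rw [hk1, hy] at hrule
  refine ⟨?_, fun hinc => ?_⟩
  · rw [mul_smul]
    by_contra hf
    exact absurd (hrule ⟨k.swap.1, Bool.eq_false_of_not_eq_true hf⟩) (by simp)
  · have h3 := (incomingEdge_iff.1 hinc).2
    rw [mul_smul, inv_smul_smul, h2] at h3
    exact k.swap_fst_ne h3.symm

/-- A crowded point is the root of binary trees of all depths: its incoming arrows come from edges
whose other ends are crowded. -/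
theorem SatisfiesOnOrbit.mem_branching {c : Config → Fin 2 × Bool} (n : ℕ) {y : Config}
    (h : SatisfiesOnOrbit c y) (hy : (c y).2 = true) {l : Letter} (hl : ¬ IncomingEdge c y l) :
    y ∈ branching n l := by
  induction n generalizing y l with
  | zero => exact Set.mem_univ y
  | succ n ih =>
    obtain ⟨k, k', hne, hk, hk'⟩ := h.crowded_iff.1 hy
    have hinc : ∀ m ∈ ({k, k'} : Finset Letter), IncomingEdge c y m := by
      simp [hk, hk']
    refine ⟨{k, k'}, Finset.card_pair hne, fun hmem => hl (hinc l hmem), fun m hm => ?_⟩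
    obtain ⟨h1, h2⟩ := h.crowded_other_end hy (hinc m hm)
    refine ⟨?_, ih (h.smul _) h1 h2⟩
    have := (incomingEdge_iff.1 (hinc m hm)).1
    rwa [smul_apply, inv_inv, mul_one] at this

theorem isInjectiveArrowSystem_of_satisfies_fundamentalRule {c : Config → Fin 2 × Bool}
    (hc : fundamentalRule.Satisfies coinMeasure c) :
    IsInjectiveArrowSystem coinMeasure fun x => (c x).1 := by
  refine ⟨_, (ae_forall_smul hc).and (ae_forall_smul ae_exists_notMem_branching), ?_⟩
  rintro x ⟨hx, hxb⟩ y - hxy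
  by_contra hne
  let k : Letter := ((c x).1, x 1)
  let k' : Letter := ((c y).1, y 1)
  let z : Config := k.val • x
  have hzy : z = k'.val • y := hxy
  have hkx : k.val⁻¹ • z = x := inv_smul_smul _ _
  have hky : k'.val⁻¹ • z = y := by rw [hzy, inv_smul_smul]
  have hkk : k ≠ k' := fun h => hne (by rw [← hkx, ← hky, h])
  have hk : IncomingEdge c z k := incomingEdge_iff.2 (by rw [hkx]; exact ⟨rfl, rfl⟩)
  have hk' : IncomingEdge c z k' := incomingEdge_iff.2 (by rw [hky]; exact ⟨rfl, rfl⟩)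
  have hz : SatisfiesOnOrbit c z := SatisfiesOnOrbit.smul (fun g => hx g) k.val
  have hcrowded : (c z).2 = true := hz.crowded_iff.2 ⟨k, k', hkk, hk, hk'⟩
  obtain ⟨h1, h2⟩ := hz.crowded_other_end hcrowded hk
  obtain ⟨n, hn⟩ := hxb (k.swap.val * k.val⁻¹ * k.val) k.swap
  rw [mul_smul] at hn
  exact hn ((hz.smul _).mem_branching n h1 h2)

end ParadoxicalColouring

theorem mainTheorem4 :
    -- the original Borel colouring exists
    (∃ c₀ : Config → Fin 17, IsOriginalColouring c₀) ∧
    -- no injective arrow system is measurable for a finitely additive invariant extension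
    (∀ (𝒜 : Set (Set Config)) (μ : AddContent ℝ≥0∞ 𝒜),
      IsInvariantExtension coinMeasure 𝒜 μ (fun (g : F₂) (x : Config) => g • x) →
      ¬ ∃ a : Config → Fin 2, IsInjectiveArrowSystem coinMeasure a ∧ ∀ i, a ⁻¹' {i} ∈ 𝒜) ∧
    ∀ c₀ : Config → Fin 17, IsOriginalColouring c₀ →
      -- the lists have two elements
      (∀ x ∈ freePart, (colourList c₀ x).card = 2) ∧
      -- proper list colouring of the secondary graph is a paradoxical colouring rule
      (listRule c₀).IsColouringRule coinMeasure ∧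
      (listRule c₀).IsParadoxical coinMeasure ∧
      -- a proper list colouring encodes an injective arrow system
      (∀ c : Config → Fin 17, (listRule c₀).Satisfies coinMeasure c →
        ∃ a : Config → Fin 2, IsInjectiveArrowSystem coinMeasure a ∧
          ∀ᵐ x ∂coinMeasure, ∀ i, c x = c₀ (target i x) ↔ i = a x) ∧
      -- every orientation satisfying the fundamental rule gives a proper list colouring
      (∀ c : Config → Fin 2 × Bool, fundamentalRule.Satisfies coinMeasure c →
        (listRule c₀).Satisfies coinMeasure (fun x => c₀ (target (c x).1 x))) := by
  refine ⟨exists_isOriginalColouring, fun 𝒜 μ hμ ⟨a, ha, hmeas⟩ => ?_, fun c₀ hc₀ => ⟨fun x hx =>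
    card_colourList hc₀ hx, isColouringRule_listRule hc₀, isParadoxical_listRule hc₀,
    fun c hc => ⟨arrowOf c₀ c, isInjectiveArrowSystem_arrowOf hc₀ hc, ae_eq_iff_eq_arrowOf hc₀ hc⟩,
    fun c hc => satisfies_listRule_of_isInjectiveArrowSystem hc₀
      (isInjectiveArrowSystem_of_satisfies_fundamentalRule hc)⟩⟩
  exact not_measurable_of_isInjectiveArrowSystem hμ (fun k l _ => ⟨k.val⁻¹ * l.val, rfl⟩) ha hmeas
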